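/- Let $\mathbb{F}_2((1/x))$ be the field of formal Laurent series in $1/x$ over the field $\mathbb{F}_2$ with two elements, with its usual (valuation) topology. A *$BS$-element* (Baum–Sweet element) is a series $f=[0,x+a_1,x+a_2,\dots]\in\mathbb{F}_2((1/x))$ with all $a_j\in\mathbb{F}_2$, i.e. the limit of the convergents of the infinite continued fraction with partial quotients $x+a_1,x+a_2,\dots$; it is called algebraic or transcendental according to whether it is so over $\mathbb{F}_2(x)$. For an infinite tableau $T=(a_i^j)_{i,j\ge 1}$, where $a_i^j$ is the entry in row $i$ and column $j$, let $L$ be the set of its row-words $a_i^1a_i^2a_i^3\cdots$, and let $$\operatorname{Perm}(T)=\{a_{\pi(1)}^1a_{\pi(2)}^2a_{\pi(3)}^3\cdots \;:\; \pi:\mathbb{N}\to\mathbb{N}\text{ a bijection}\};$$ $T$ is *Cantorian* if $\operatorname{Perm}(T)\cap L=\emptyset$. **Proposition (Baum–Sweet elements).** The sequences of partial quotients $(x+a_1,x+a_2,\dots)$ of the algebraic $BS$-elements can be listed, each exactly once, as the rows of an infinite tableau indexed by $\mathbb{N}\times\mathbb{N}$. For every infinite tableau $T$ whose set of row-words is exactly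 the set of these sequences (the rows being in any order, repetitions allowed), $T$ is Cantorian, and $\operatorname{Perm}(T)$ is exactly the set of sequences of partial quotients of the transcendental $BS$-elements; moreover, the set of values $[0,A_1,A_2,\dots]$ of the words $A_1A_2\cdots\in\operatorname{Perm}(T)$ is exactly the set of all transcendental $BS$-elements. -/

import Mathlib

open Filter Topology Polynomial

noncomputable section

namespace BaumSweet

/-! ### Infinite tableaux -/

/-- An infinite tableau over an alphabet `A`: `T i j` is the letter in row `i` and column `j`,
and `T i` is the `i`-th row-word. -/
abbrev Tableau (A : Type*) := ℕ → ℕ → A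

/-- The set `L` of row-words of an infinite tableau. -/
def rowWords {A : Type*} (T : Tableau A) : Set (ℕ → A) := Set.range T

/-- The permanent of an infinite tableau: the set of all diagonal words
`T (π 0) 0, T (π 1) 1, T (π 2) 2, …`, where `π` runs over the bijections of `ℕ`. -/
def permanent {A : Type*} (T : Tableau A) : Set (ℕ → A) :=
  {w | ∃ π : Equiv.Perm ℕ, ∀ j, w j = T (π j) j}

/-- A tableau is Cantorian if no row-word belongs to its permanent. -/
def IsCantorian {A : Type*} (T : Tableau A) : Prop :=
  permanent T ∩ rowWords T = ∅

/-! ### Continued fractions of formal power series in `1/x` over the field with two elements -/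

/-- The field `𝔽₂` with two elements. -/
abbrev F2 := ZMod 2

/-- The field `𝔽₂((1/x))` of formal Laurent series in the variable `1/x`: the coefficient of index
`n : ℤ` of an element is its coefficient at `x⁻ⁿ`. It carries Mathlib's valuation topology, in which
a series is close to `0` if its coefficients vanish up to a large index. -/
abbrev SeriesAtInfty := LaurentSeries F2

/-- The element `x` of `𝔽₂((1/x))`, the series with the single coefficient `1` at index `-1`. -/
def x : SeriesAtInfty := HahnSeries.single (-1 : ℤ) (1 : F2)

/-- The subfield `𝔽₂(x)` of rational functions inside `𝔽₂((1/x))`. -/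
abbrev rationalFunctions : IntermediateField F2 SeriesAtInfty := IntermediateField.adjoin F2 {x}

/-- The formal continued fraction `[0, A 0, A 1, A 2, …]` with polynomial partial quotients. -/
def contFract (A : ℕ → F2[X]) : GenContFract SeriesAtInfty where
  h := 0
  s := Stream'.Seq.ofStream (fun j => ⟨1, aeval x (A j)⟩)

/-- `f = [0, A 0, A 1, A 2, …]`: the convergents of the continued fraction tend to `f`. -/
def HasContFract (A : ℕ → F2[X]) (f : SeriesAtInfty) : Prop :=
  Tendsto (contFract A).convs atTop (𝓝 f)

/-- A sequence of partial quotients of the form `x + a 0, x + a 1, x + a 2, …` with `a j ∈ 𝔽₂`. -/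
def IsBSSequence (A : ℕ → F2[X]) : Prop :=
  ∃ a : ℕ → F2, ∀ j, A j = X + C (a j)

/-- The `BS`-elements: the series `[0, x + a 0, x + a 1, …]` with all `a j ∈ 𝔽₂`. -/
def IsBSElement (f : SeriesAtInfty) : Prop :=
  ∃ A, IsBSSequence A ∧ HasContFract A f

/-- The sequences of partial quotients of the `BS`-elements algebraic over `𝔽₂(x)`. -/
def algebraicBSSequences : Set (ℕ → F2[X]) :=
  {A | IsBSSequence A ∧ ∃ f, HasContFract A f ∧ IsAlgebraic rationalFunctions f}

/-- The sequences of partial quotients of the `BS`-elements transcendental over `𝔽₂(x)`. -/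
def transcendentalBSSequences : Set (ℕ → F2[X]) :=
  {A | IsBSSequence A ∧ ∃ f, HasContFract A f ∧ Transcendental rationalFunctions f}

end BaumSweet

end

noncomputable section

namespace BaumSweet

open WithZero

/-! Encode a sequence of partial quotients by its binary word. The set of algebraic words is
countable, infinite, and closed under letterwise complement and finite changes; `permanent_eq_compl`
shows that these closures alone make the permanent the complement of the row set. A row cannot lie
in the permanent, because its complementary row is used in some column. If `w` is not a row, it
agrees with each row infinitely often, and each column contains `w`'s letter infinitely often, so
Schröder–Bernstein yields a bijection.

Finite changes preserve algebraicity since prepending a letter is a Möbius map over `𝔽₂(x)`.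
Complementing letters amounts to replacing `x` by `x + 1`; as valuations of rational functions
depend only on degrees, a polynomial relation survives this substitution (`eval₂_ratEval_eq_zero`,
`isAlgebraic_value_add_one`). -/

/-! ### Permanents of tableaux -/

/-- A relation on `ℕ × ℕ` all of whose rows and columns are infinite contains the graph of a
bijection. -/
theorem exists_perm_of_frequently {R : ℕ → ℕ → Prop} (hrow : ∀ i, ∃ᶠ j in atTop, R i j)
    (hcol : ∀ j, ∃ᶠ i in atTop, R i j) : ∃ π : Equiv.Perm ℕ, ∀ j, R (π j) j := by
  obtain ⟨f, hf, hfR⟩ := extraction_forall_of_frequently hrow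
  obtain ⟨g, hg, hgR⟩ := extraction_forall_of_frequently hcol
  -- The Schröder–Bernstein bijection pairs each column `j` with `g j` or with an `f`-preimage of
  -- `j`, so it stays inside `R`.
  obtain ⟨h, hh, hR⟩ := Function.Embedding.schroeder_bernstein_of_rel hg.injective hf.injective
    (fun j i => R i j) hgR hfR
  exact ⟨Equiv.ofBijective h hh, hR⟩

/-- Two words that differ in finitely many letters only. -/
def EventuallySame {A : Type*} (u w : ℕ → A) : Prop := ∀ᶠ j in atTop, u j = w j

/-- The permanent of a tableau of binary words whose set of rows is closed under letterwise
complement and under changing finitely many letters. -/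
theorem permanent_eq_compl {T : Tableau F2} (hcompl : ∀ i, T i + 1 ∈ rowWords T)
    (hfin : ∀ i, ∀ w, EventuallySame w (T i) → w ∈ rowWords T) :
    permanent T = (rowWords T)ᶜ := by
  have hne : ∀ a : F2, a + 1 ≠ a := by decide
  have htwo : ∀ a b : F2, a ≠ b → a = b + 1 := by decide
  ext w
  constructor
  · rintro ⟨π, hπ⟩ ⟨i, rfl⟩
    obtain ⟨k, hk⟩ := hcompl i
    have h := hπ (π.symm k)
    rw [Equiv.apply_symm_apply, hk] at h
    exact hne _ h.symm
  · intro hw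
    suffices h : ∃ π : Equiv.Perm ℕ, ∀ j, w j = T (π j) j from h
    refine exists_perm_of_frequently (R := fun i j => w j = T i j) (fun i hfr => hw ?_) (fun j => ?_)
    · obtain ⟨k, hk⟩ := hcompl i
      -- `hfr` says that `w` eventually differs from row `i`; over two letters it then eventually
      -- equals the complementary row `k`.
      refine hfin k w (hfr.mono fun j hj => ?_)
      rw [hk]
      exact htwo _ _ hj
    -- Row 0 with `w j` forced in column `j`; the flip at `j + 1 + n` makes these rows distinct as
    -- `n` varies.
    · have hfilled : ∀ n : ℕ, ∃ i, ∀ k, T i k = if k = j then w j else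
          if k = j + 1 + n then T 0 k + 1 else T 0 k := by
        intro n
        obtain ⟨i, hi⟩ := hfin 0 (fun k => if k = j then w j else
          if k = j + 1 + n then T 0 k + 1 else T 0 k) (by
            filter_upwards [eventually_gt_atTop (j + 1 + n)] with k hk
            rw [if_neg (by omega), if_neg (by omega)])
        exact ⟨i, fun k => congrFun hi k⟩
      choose g hg using hfilled
      have hginj : Function.Injective g := by
        intro m n hmn
        by_contra h
        have h1 := hg m (j + 1 + m)
        rw [hmn, hg n, if_neg (by omega), if_neg (by omega), if_neg (by omega), if_pos rfl] at h1
        exact hne _ h1.symm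
      rw [Nat.frequently_atTop_iff_infinite]
      refine (Set.infinite_range_of_injective hginj).mono ?_
      rintro _ ⟨n, rfl⟩
      simp [hg n j]

/-! ### The valuation topology -/

theorem valuation_algebraMap (a : F2) (ha : a ≠ 0) :
    Valued.v (algebraMap F2 SeriesAtInfty a) = (1 : ℤᵐ⁰) := by
  have : a = 1 := by revert a; decide
  rw [this, map_one, map_one]

theorem valuation_algebraMap_le (a : F2) :
    Valued.v (algebraMap F2 SeriesAtInfty a) ≤ (1 : ℤᵐ⁰) := by
  rcases eq_or_ne a 0 with rfl | ha
  · simp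
  · exact (valuation_algebraMap a ha).le

theorem valuation_x : Valued.v x = (exp 1 : ℤᵐ⁰) := by
  rw [x, LaurentSeries.valuation_single_zpow, neg_neg]

theorem exp_neg_natCast_lt {γ : ℤᵐ⁰} (hγ : γ ≠ 0) : ∃ N : ℕ, exp (-(N : ℤ)) < γ := by
  refine ⟨(1 - log γ).toNat, ?_⟩
  rw [← lt_log_iff_exp_lt hγ]
  omega

theorem hasBasis_nhds_zero_exp : (𝓝 (0 : SeriesAtInfty)).HasBasis (fun _ : ℕ => True)
    fun N => {f | Valued.v f < (exp (-(N : ℤ)) : ℤᵐ⁰)} := by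
  refine (Valued.hasBasis_nhds_zero SeriesAtInfty ℤᵐ⁰).to_hasBasis ?_ ?_
  · intro γ _
    obtain ⟨N, hN⟩ := exp_neg_natCast_lt (γ := MonoidWithZeroHom.ValueGroup₀.embedding γ.1)
      (by simp)
    refine ⟨N, trivial, fun f hf => ?_⟩
    rw [Set.mem_ofPred_eq, Valuation.restrict_lt_iff_lt_embedding]
    exact lt_trans hf hN
  · intro N _
    have hs := LaurentSeries.valuation_single_zpow F2 N
    refine ⟨Units.mk0 (Valued.v.restrict (HahnSeries.single (N : ℤ) (1 : F2))) ?_, trivial,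
      fun f hf => ?_⟩
    · rw [Valuation.ne_zero_iff]
      simp
    · rw [Set.mem_ofPred_eq, Units.val_mk0, Valuation.restrict_lt_iff, hs] at hf
      exact hf

theorem tendsto_zero_iff {u : ℕ → SeriesAtInfty} : Tendsto u atTop (𝓝 0) ↔
    ∀ N : ℕ, ∀ᶠ n in atTop, Valued.v (u n) < (exp (-(N : ℤ)) : ℤᵐ⁰) := by
  rw [hasBasis_nhds_zero_exp.tendsto_right_iff]
  simp

theorem tendsto_zero_of_valuation_eq {u w : ℕ → SeriesAtInfty}
    (h : ∀ n, Valued.v (u n) = (Valued.v (w n) : ℤᵐ⁰)) (hu : Tendsto u atTop (𝓝 0)) :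
    Tendsto w atTop (𝓝 0) := by
  rw [tendsto_zero_iff] at hu ⊢
  simpa only [h] using hu

theorem valuation_lt_one_of_tendsto {u : ℕ → SeriesAtInfty} {f : SeriesAtInfty}
    (hu : Tendsto u atTop (𝓝 f)) (h : ∀ n, Valued.v (u n) < (1 : ℤᵐ⁰)) :
    Valued.v f < (1 : ℤᵐ⁰) := by
  have h0 : Tendsto (fun n => u n - f) atTop (𝓝 0) := by
    simpa using hu.sub_const f
  obtain ⟨n, hn⟩ := (tendsto_zero_iff.1 h0 0).exists
  have : f = u n - (u n - f) := by ring
  rw [this]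
  exact Valuation.map_sub_lt _ (h n) (by simpa using hn)

theorem exists_tendsto_of_valuation_sub_le {u : ℕ → SeriesAtInfty}
    (h : ∀ n m, n ≤ m → Valued.v (u m - u n) ≤ (exp (-(n : ℤ)) : ℤᵐ⁰)) :
    ∃ f, Tendsto u atTop (𝓝 f) := by
  refine cauchySeq_tendsto_of_complete ?_
  rw [CauchySeq, Valued.cauchy_iff]
  refine ⟨inferInstance, fun γ => ?_⟩
  obtain ⟨N, hN⟩ := exp_neg_natCast_lt (γ := MonoidWithZeroHom.ValueGroup₀.embedding γ.1)
    (by simp)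
  refine ⟨u '' Set.Ici N, image_mem_map (Ici_mem_atTop N), ?_⟩
  rintro _ ⟨m, hm, rfl⟩ _ ⟨n, hn, rfl⟩
  rw [Valuation.restrict_lt_iff_lt_embedding]
  refine lt_of_le_of_lt ?_ hN
  have : u n - u m = (u n - u N) - (u m - u N) := by ring
  rw [this]
  exact Valuation.map_sub_le _ (h N n hn) (h N m hm)


/-! ### Convergents -/

/-- The sequence of partial quotients `x + a 0, x + a 1, …`. -/
def quotients (a : ℕ → F2) : ℕ → F2[X] := fun j => X + C (a j)

theorem quotients_injective : Function.Injective quotients := by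
  intro a b h
  funext j
  exact C_injective (add_left_cancel (congrFun h j))

theorem isBSSequence_iff {A : ℕ → F2[X]} : IsBSSequence A ↔ A ∈ Set.range quotients := by
  constructor
  · rintro ⟨a, ha⟩
    exact ⟨a, (funext ha).symm⟩
  · rintro ⟨a, rfl⟩
    exact ⟨a, fun _ => rfl⟩

/-- The word without its first letter. -/
def shift {A : Type*} (a : ℕ → A) : ℕ → A := fun j => a (j + 1)

/-- The value at `y` of the finite continued fraction `[0, y + a 0, …, y + a (n - 1)]`. -/
def convergent {K : Type*} [Field K] [Algebra F2 K] (y : K) : ℕ → (ℕ → F2) → K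
  | 0, _ => 0
  | n + 1, a => (y + algebraMap F2 K (a 0) + convergent y n (shift a))⁻¹

theorem map_convergent {K L : Type*} [Field K] [Algebra F2 K] [Field L] [Algebra F2 L]
    (φ : K →ₐ[F2] L) (y : K) (n : ℕ) (a : ℕ → F2) :
    φ (convergent y n a) = convergent (φ y) n a := by
  induction n generalizing a with
  | zero => simp [convergent]
  | succ n ih => simp [convergent, ih]

theorem convergent_add_one {K : Type*} [Field K] [Algebra F2 K] (y : K) (n : ℕ) (a : ℕ → F2) :
    convergent y n (a + 1) = convergent (y + 1) n a := by
  induction n generalizing a with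
  | zero => rfl
  | succ n ih =>
    have : shift (a + 1) = shift a + 1 := rfl
    rw [convergent, convergent, this, ih, Pi.add_apply, Pi.one_apply, map_add, map_one]
    congr 2
    ring

theorem valuation_add_of_lt {y z : SeriesAtInfty} (c : F2) (hy : Valued.v y = (exp 1 : ℤᵐ⁰))
    (hz : Valued.v z < (1 : ℤᵐ⁰)) :
    Valued.v (y + algebraMap F2 SeriesAtInfty c + z) = (exp 1 : ℤᵐ⁰) := by
  have h1 : (1 : ℤᵐ⁰) < exp 1 := by rw [← exp_zero, exp_lt_exp]; norm_num
  rw [add_assoc, Valuation.map_add_eq_of_lt_left, hy]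
  rw [hy]
  exact Valuation.map_add_lt _ ((valuation_algebraMap_le c).trans_lt h1) (hz.trans h1)

theorem exp_neg_one_lt_one : (exp (-1) : ℤᵐ⁰) < 1 := by
  rw [← exp_zero, exp_lt_exp]; norm_num

theorem valuation_convergent_lt {y : SeriesAtInfty} (hy : Valued.v y = (exp 1 : ℤᵐ⁰)) (n : ℕ)
    (a : ℕ → F2) : Valued.v (convergent y n a) < (1 : ℤᵐ⁰) := by
  induction n generalizing a with
  | zero => simp [convergent]
  | succ n ih =>
    rw [convergent, map_inv₀, valuation_add_of_lt _ hy (ih _), ← exp_neg]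
    exact exp_neg_one_lt_one

theorem ne_zero_of_valuation_eq_exp {f : SeriesAtInfty} {k : ℤ}
    (h : Valued.v f = (exp k : ℤᵐ⁰)) : f ≠ 0 := by
  rintro rfl
  rw [map_zero] at h
  exact exp_ne_zero h.symm

/-- Since `1/s - 1/t = (t - s)/(st)` and both denominators have valuation `exp 1`, each level gains
a factor `exp (-2)`, more than needed. -/
theorem valuation_convergent_sub_le {y : SeriesAtInfty} (hy : Valued.v y = (exp 1 : ℤᵐ⁰))
    (n m : ℕ) (hnm : n ≤ m) (a : ℕ → F2) :
    Valued.v (convergent y m a - convergent y n a) ≤ (exp (-(n : ℤ)) : ℤᵐ⁰) := by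
  induction n generalizing m a with
  | zero => simpa [convergent] using (valuation_convergent_lt hy m a).le
  | succ n ih =>
    obtain ⟨m, rfl⟩ : ∃ k, m = k + 1 := ⟨m - 1, by omega⟩
    have hm := valuation_add_of_lt (a 0) hy (valuation_convergent_lt hy m (shift a))
    have hn := valuation_add_of_lt (a 0) hy (valuation_convergent_lt hy n (shift a))
    rw [convergent, convergent, inv_sub_inv (ne_zero_of_valuation_eq_exp hm)
      (ne_zero_of_valuation_eq_exp hn), add_sub_add_left_eq_sub, map_div₀, map_mul, hm, hn,
      Valuation.map_sub_swap, ← exp_add]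
    rw [div_le_iff₀ (by simp)]
    refine (ih m (by omega) (shift a)).trans ?_
    rw [← exp_add, exp_le_exp]
    push_cast
    omega

theorem contFract_s_get (A : ℕ → F2[X]) (n : ℕ) :
    (contFract A).s.get? n = some ⟨1, aeval x (A n)⟩ := rfl

/-- The continuant recurrence appends quotients at the end, whereas `convergent` peels off the first
one; this reconciles the two. -/
theorem contsAux_shift (A : ℕ → F2[X]) (n : ℕ) :
    (contFract A).contsAux (n + 1) = ⟨((contFract (shift A)).contsAux n).b,
      aeval x (A 0) * ((contFract (shift A)).contsAux n).b +
        ((contFract (shift A)).contsAux n).a⟩ := by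
  induction n using Nat.twoStepInduction with
  | zero => simp [GenContFract.contsAux, contFract]
  | one =>
    rw [GenContFract.contsAux_recurrence (contFract_s_get A 0) rfl rfl]
    simp [GenContFract.contsAux, contFract]
  | more n h1 h2 =>
    rw [GenContFract.contsAux_recurrence (contFract_s_get A (n + 1)) h1 h2,
      GenContFract.contsAux_recurrence (contFract_s_get (shift A) n) rfl rfl]
    simp only [shift]
    congr 1
    ring

/-- The claims need a joint induction: the new denominator is the old one times `x + a 0 +
convergent`, a factor of valuation `exp 1`. -/
theorem dens_ne_zero_and_convs (n : ℕ) (a : ℕ → F2) :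
    (contFract (quotients a)).dens n ≠ 0 ∧
      (contFract (quotients a)).convs n = convergent x n a := by
  induction n generalizing a with
  | zero => simp [convergent, contFract]
  | succ n ih =>
    obtain ⟨hd, hc⟩ := ih (shift a)
    have hs : shift (quotients a) = quotients (shift a) := rfl
    have haux := contsAux_shift (quotients a) (n + 1)
    rw [hs] at haux
    have hnum : (contFract (quotients a)).nums (n + 1) =
        (contFract (quotients (shift a))).dens n := congrArg GenContFract.Pair.a haux
    have hden : (contFract (quotients a)).dens (n + 1) =
        aeval x (quotients a 0) * (contFract (quotients (shift a))).dens n +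
          (contFract (quotients (shift a))).nums n := congrArg GenContFract.Pair.b haux
    rw [GenContFract.conv_eq_num_div_den] at hc ⊢
    have hfac : (contFract (quotients a)).dens (n + 1) =
        (x + algebraMap F2 SeriesAtInfty (a 0) + convergent x n (shift a)) *
          (contFract (quotients (shift a))).dens n := by
      rw [hden, ← hc]
      simp only [quotients, map_add, aeval_X, aeval_C]
      field_simp
    have hne := ne_zero_of_valuation_eq_exp
      (valuation_add_of_lt (a 0) valuation_x (valuation_convergent_lt valuation_x n (shift a)))
    refine ⟨by rw [hfac]; exact mul_ne_zero hne hd, ?_⟩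
    rw [hnum, hfac, convergent]
    field_simp

theorem hasContFract_quotients_iff {a : ℕ → F2} {f : SeriesAtInfty} :
    HasContFract (quotients a) f ↔ Tendsto (fun n => convergent x n a) atTop (𝓝 f) := by
  rw [HasContFract, funext fun n => (dens_ne_zero_and_convs n a).2]

/-! ### Values of infinite continued fractions -/

theorem exists_hasContFract (a : ℕ → F2) : ∃ f, HasContFract (quotients a) f := by
  simp only [hasContFract_quotients_iff]
  exact exists_tendsto_of_valuation_sub_le fun n m hnm =>
    valuation_convergent_sub_le valuation_x n m hnm a

/-- The value of the infinite continued fraction `[0, x + a 0, x + a 1, …]`. -/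
def value (a : ℕ → F2) : SeriesAtInfty := (exists_hasContFract a).choose

theorem hasContFract_value (a : ℕ → F2) : HasContFract (quotients a) (value a) :=
  (exists_hasContFract a).choose_spec

theorem tendsto_value (a : ℕ → F2) :
    Tendsto (fun n => convergent x n a) atTop (𝓝 (value a)) :=
  hasContFract_quotients_iff.1 (hasContFract_value a)

theorem hasContFract_iff_eq_value {a : ℕ → F2} {f : SeriesAtInfty} :
    HasContFract (quotients a) f ↔ f = value a :=
  ⟨fun h => tendsto_nhds_unique h (hasContFract_value a), fun h => h ▸ hasContFract_value a⟩

theorem valuation_value_lt (a : ℕ → F2) : Valued.v (value a) < (1 : ℤᵐ⁰) :=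
  valuation_lt_one_of_tendsto (tendsto_value a) fun n => valuation_convergent_lt valuation_x n a

theorem value_eq_inv (a : ℕ → F2) :
    value a = (x + algebraMap F2 SeriesAtInfty (a 0) + value (shift a))⁻¹ := by
  have hne := ne_zero_of_valuation_eq_exp
    (valuation_add_of_lt (a 0) valuation_x (valuation_value_lt (shift a)))
  exact tendsto_nhds_unique ((tendsto_add_atTop_iff_nat 1).2 (tendsto_value a))
    (((tendsto_value (shift a)).const_add _).inv₀ hne)

/-- Distinct heads would differ by a constant of valuation 1, but the tails have valuation below 1.
-/
theorem head_eq_and_value_shift_eq {a b : ℕ → F2} (h : value a = value b) :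
    a 0 = b 0 ∧ value (shift a) = value (shift b) := by
  rw [value_eq_inv a, value_eq_inv b, inv_inj, add_assoc, add_assoc] at h
  have h := add_left_cancel h
  have h0 : a 0 = b 0 := by
    by_contra hne
    have hv := valuation_algebraMap (a 0 - b 0) (sub_ne_zero.2 hne)
    have : algebraMap F2 SeriesAtInfty (a 0 - b 0) = value (shift b) - value (shift a) := by
      rw [map_sub]
      linear_combination h
    rw [this] at hv
    exact (Valuation.map_sub_lt _ (valuation_value_lt _) (valuation_value_lt _)).ne hv
  rw [h0] at h
  exact ⟨h0, add_left_cancel h⟩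

theorem value_injective : Function.Injective value := by
  intro a b h
  funext j
  induction j generalizing a b with
  | zero => exact (head_eq_and_value_shift_eq h).1
  | succ j ih => exact ih (head_eq_and_value_shift_eq h).2


/-! ### Specializations of the field of rational functions -/

theorem valuation_aeval {y : SeriesAtInfty} (hy : Valued.v y = (exp 1 : ℤᵐ⁰)) {p : F2[X]}
    (hp : p ≠ 0) : Valued.v (aeval y p) = (exp 1 : ℤᵐ⁰) ^ p.natDegree := by
  have : (Valued.v : Valuation SeriesAtInfty ℤᵐ⁰).IsTrivialOn F2 := ⟨valuation_algebraMap⟩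
  rw [valuation_aeval_eq_valuation_X_pow_natDegree_of_one_lt_valuation_X y _ hp, hy]
  rw [hy, ← exp_zero, exp_lt_exp]
  norm_num

theorem aeval_injective {y : SeriesAtInfty} (hy : Valued.v y = (exp 1 : ℤᵐ⁰)) :
    Function.Injective (aeval (R := F2) y) := by
  rw [injective_iff_map_eq_zero]
  intro p hp
  by_contra h
  have := valuation_aeval hy h
  rw [hp, map_zero] at this
  exact pow_ne_zero _ exp_ne_zero this.symm

/-- The embedding of the field of rational functions that sends the variable to `y`. -/
def ratEval {y : SeriesAtInfty} (hy : Valued.v y = (exp 1 : ℤᵐ⁰)) :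
    RatFunc F2 →ₐ[F2] SeriesAtInfty :=
  IsFractionRing.liftAlgHom (A := F2[X]) (g := aeval y) (aeval_injective hy)

theorem ratEval_algebraMap {y : SeriesAtInfty} (hy : Valued.v y = (exp 1 : ℤᵐ⁰)) (p : F2[X]) :
    ratEval hy (algebraMap F2[X] (RatFunc F2) p) = aeval y p := by
  rw [ratEval, IsFractionRing.liftAlgHom_apply]
  exact IsFractionRing.lift_algebraMap _ p

theorem ratEval_X {y : SeriesAtInfty} (hy : Valued.v y = (exp 1 : ℤᵐ⁰)) :
    ratEval hy RatFunc.X = y := by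
  rw [← RatFunc.algebraMap_X, ratEval_algebraMap, aeval_X]

theorem valuation_ratEval {y z : SeriesAtInfty} (hy : Valued.v y = (exp 1 : ℤᵐ⁰))
    (hz : Valued.v z = (exp 1 : ℤᵐ⁰)) (r : RatFunc F2) :
    Valued.v (ratEval hy r) = (Valued.v (ratEval hz r) : ℤᵐ⁰) := by
  obtain ⟨p, q, hq, rfl⟩ := IsFractionRing.div_surjective (A := F2[X]) r
  rcases eq_or_ne p 0 with rfl | hp
  · simp
  · simp only [map_div₀, ratEval_algebraMap]
    rw [valuation_aeval hy hp, valuation_aeval hz hp, valuation_aeval hy (nonZeroDivisors.ne_zero hq),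
      valuation_aeval hz (nonZeroDivisors.ne_zero hq)]

theorem ratEval_mem {y : SeriesAtInfty} (hy : Valued.v y = (exp 1 : ℤᵐ⁰))
    (h : y ∈ rationalFunctions) (r : RatFunc F2) : ratEval hy r ∈ rationalFunctions := by
  obtain ⟨p, q, -, rfl⟩ := IsFractionRing.div_surjective (A := F2[X]) r
  have hmem : ∀ s : F2[X], aeval y s ∈ rationalFunctions := fun s => by
    rw [aeval_eq_sum_range]
    exact sum_mem fun i _ => IntermediateField.smul_mem _ (pow_mem h i)
  simp only [map_div₀, ratEval_algebraMap]
  exact div_mem (hmem p) (hmem q)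

theorem x_mem_rationalFunctions : x ∈ rationalFunctions :=
  IntermediateField.mem_adjoin_simple_self F2 x

theorem exists_ratEval_eq {f : SeriesAtInfty} (hf : f ∈ rationalFunctions) :
    ∃ r, ratEval valuation_x r = f := by
  obtain ⟨p, q, rfl⟩ := (IntermediateField.mem_adjoin_simple_iff F2 f).1 hf
  exact ⟨algebraMap _ _ p / algebraMap _ _ q, by simp only [map_div₀, ratEval_algebraMap]⟩

/-! ### Closure properties of the algebraic values -/

theorem isAlgebraic_of_eval₂_ratEval {y f : SeriesAtInfty} (hy : Valued.v y = (exp 1 : ℤᵐ⁰))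
    (h : y ∈ rationalFunctions) {Q : (RatFunc F2)[X]} (hQ : Q ≠ 0)
    (hf : Q.eval₂ (ratEval hy : RatFunc F2 →+* SeriesAtInfty) f = 0) :
    IsAlgebraic rationalFunctions f := by
  let φ : RatFunc F2 →+* rationalFunctions :=
    (ratEval hy : RatFunc F2 →+* SeriesAtInfty).codRestrict rationalFunctions (ratEval_mem hy h)
  refine ⟨Q.map φ, (Polynomial.map_ne_zero_iff φ.injective).2 hQ, ?_⟩
  rw [aeval_def, eval₂_map]
  exact hf

theorem exists_eval₂_ratEval_of_isAlgebraic {f : SeriesAtInfty}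
    (hf : IsAlgebraic rationalFunctions f) : ∃ Q : (RatFunc F2)[X], Q ≠ 0 ∧
      Q.eval₂ (ratEval valuation_x : RatFunc F2 →+* SeriesAtInfty) f = 0 := by
  obtain ⟨P, hP, hPf⟩ := hf
  let φ : RatFunc F2 →+* rationalFunctions :=
    (ratEval valuation_x : RatFunc F2 →+* SeriesAtInfty).codRestrict rationalFunctions
      (ratEval_mem valuation_x x_mem_rationalFunctions)
  have hφ : Function.Surjective φ := fun g => by
    obtain ⟨r, hr⟩ := exists_ratEval_eq g.2
    exact ⟨r, Subtype.ext hr⟩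
  obtain ⟨Q, rfl⟩ := Polynomial.map_surjective φ hφ P
  refine ⟨Q, fun h => hP (by rw [h, Polynomial.map_zero]), ?_⟩
  rw [aeval_def, eval₂_map] at hPf
  exact hPf

/-- Whether `[0, y + a 0, y + a 1, …]` is a root of a polynomial over the field of rational
functions in `y` does not depend on `y`. -/
theorem eval₂_ratEval_eq_zero {y z f g : SeriesAtInfty} (hy : Valued.v y = (exp 1 : ℤᵐ⁰))
    (hz : Valued.v z = (exp 1 : ℤᵐ⁰)) {a : ℕ → F2}
    (hf : Tendsto (fun n => convergent y n a) atTop (𝓝 f))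
    (hg : Tendsto (fun n => convergent z n a) atTop (𝓝 g)) {Q : (RatFunc F2)[X]}
    (hQ : Q.eval₂ (ratEval hy : RatFunc F2 →+* SeriesAtInfty) f = 0) :
    Q.eval₂ (ratEval hz : RatFunc F2 →+* SeriesAtInfty) g = 0 := by
  -- `Q` at the `n`-th convergent is the image of one rational function independent of `w`, so its
  -- valuation is too.
  have key : ∀ {w k : SeriesAtInfty} (hw : Valued.v w = (exp 1 : ℤᵐ⁰)),
      Tendsto (fun n => convergent w n a) atTop (𝓝 k) →
      Tendsto (fun n => ratEval hw (Q.eval (convergent RatFunc.X n a))) atTop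
        (𝓝 (Q.eval₂ (ratEval hw : RatFunc F2 →+* SeriesAtInfty) k)) := by
    intro w k hw hk
    have hc : Continuous fun t => Q.eval₂ (ratEval hw : RatFunc F2 →+* SeriesAtInfty) t := by
      simp only [eval₂_eq_eval_map]
      exact Polynomial.continuous _
    refine ((hc.tendsto k).comp hk).congr fun n => ?_
    have h := map_convergent (ratEval hw) RatFunc.X n a
    rw [ratEval_X] at h
    rw [Function.comp_apply, ← h]
    exact Polynomial.eval₂_hom (ratEval hw : RatFunc F2 →+* SeriesAtInfty) _
  have h0 := key hy hf
  rw [hQ] at h0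
  exact tendsto_nhds_unique (key hz hg)
    (tendsto_zero_of_valuation_eq (fun n => valuation_ratEval hy hz _) h0)

theorem isAlgebraic_value_add_one {a : ℕ → F2} (h : IsAlgebraic rationalFunctions (value a)) :
    IsAlgebraic rationalFunctions (value (a + 1)) := by
  obtain ⟨Q, hQ, hQa⟩ := exists_eval₂_ratEval_of_isAlgebraic h
  have hx1 : Valued.v (x + 1) = (exp 1 : ℤᵐ⁰) := by
    simpa using valuation_add_of_lt (z := 0) 1 valuation_x (by simp)
  refine isAlgebraic_of_eval₂_ratEval hx1 (add_mem x_mem_rationalFunctions (one_mem _)) hQ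
    (eval₂_ratEval_eq_zero valuation_x hx1 (tendsto_value a) ?_ hQa)
  simpa only [convergent_add_one] using tendsto_value (a + 1)

theorem isAlgebraic_x_add (c : F2) :
    IsAlgebraic rationalFunctions (x + algebraMap F2 SeriesAtInfty c) :=
  isAlgebraic_algebraMap
    (⟨_, add_mem x_mem_rationalFunctions (algebraMap_mem _ c)⟩ : rationalFunctions)

theorem isAlgebraic_value_shift_iff {a : ℕ → F2} :
    IsAlgebraic rationalFunctions (value (shift a)) ↔ IsAlgebraic rationalFunctions (value a) := by
  constructor
  · intro h
    rw [value_eq_inv]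
    exact ((isAlgebraic_x_add _).add h).inv
  · intro h
    have : value (shift a) = (value a)⁻¹ - (x + algebraMap F2 SeriesAtInfty (a 0)) := by
      rw [value_eq_inv a, inv_inv]
      ring
    rw [this]
    exact h.inv.sub (isAlgebraic_x_add _)

theorem isAlgebraic_value_of_eventuallySame {a b : ℕ → F2} (hab : EventuallySame b a)
    (h : IsAlgebraic rationalFunctions (value a)) : IsAlgebraic rationalFunctions (value b) := by
  obtain ⟨N, hN⟩ := eventually_atTop.1 hab
  induction N generalizing a b with
  | zero => rwa [show b = a from funext fun j => hN j (Nat.zero_le j)]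
  | succ N ih =>
    rw [← isAlgebraic_value_shift_iff] at h ⊢
    exact ih ((tendsto_add_atTop_nat 1).eventually hab) h fun j hj => hN (j + 1) (by omega)

/-- The constant word is its own shift, giving `t² + x t - 1 = 0`. Finite changes of it supply
infinitely many algebraic words. -/
theorem isAlgebraic_value_zero : IsAlgebraic rationalFunctions (value 0) := by
  have hne := ne_zero_of_valuation_eq_exp
    (valuation_add_of_lt 0 valuation_x (valuation_value_lt 0))
  have h := value_eq_inv 0
  rw [show shift (0 : ℕ → F2) = 0 from rfl] at h
  rw [Pi.zero_apply] at h
  rw [map_zero, add_zero] at h hne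
  have hq : value 0 * value 0 + x * value 0 - 1 = 0 := by
    have : value 0 * (x + value 0) = 1 := by
      nth_rw 1 [h]
      exact inv_mul_cancel₀ hne
    linear_combination this
  have hmonic : (X ^ 2 + (C ⟨x, x_mem_rationalFunctions⟩ * X - 1) :
      rationalFunctions[X]).Monic := by
    refine monic_X_pow_add ?_
    refine lt_of_le_of_lt (degree_sub_le _ _) (max_lt ?_ ?_)
    · exact lt_of_le_of_lt (degree_C_mul_X_le _) (by norm_num)
    · rw [degree_one]; norm_num
  refine ⟨_, hmonic.ne_zero, ?_⟩
  simp only [map_add, map_sub, map_mul, map_pow, map_one, aeval_X, aeval_C]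
  rw [← hq, pow_two]
  have : algebraMap rationalFunctions SeriesAtInfty ⟨x, x_mem_rationalFunctions⟩ = x := rfl
  rw [this]
  ring

/-! ### The words of the algebraic values -/

/-- The words `a` such that `[0, x + a 0, x + a 1, …]` is algebraic. -/
def algebraicWords : Set (ℕ → F2) := {a | IsAlgebraic rationalFunctions (value a)}

theorem algebraicBSSequences_eq : algebraicBSSequences = quotients '' algebraicWords := by
  ext A
  constructor
  · rintro ⟨hA, f, hf, halg⟩
    obtain ⟨a, rfl⟩ := isBSSequence_iff.1 hA
    rw [hasContFract_iff_eq_value] at hf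
    subst hf
    exact ⟨a, halg, rfl⟩
  · rintro ⟨a, ha, rfl⟩
    exact ⟨isBSSequence_iff.2 ⟨a, rfl⟩, value a, hasContFract_value a, ha⟩

theorem transcendentalBSSequences_eq :
    transcendentalBSSequences = quotients '' algebraicWordsᶜ := by
  ext A
  constructor
  · rintro ⟨hA, f, hf, htr⟩
    obtain ⟨a, rfl⟩ := isBSSequence_iff.1 hA
    rw [hasContFract_iff_eq_value] at hf
    subst hf
    exact ⟨a, htr, rfl⟩
  · rintro ⟨a, ha, rfl⟩
    exact ⟨isBSSequence_iff.2 ⟨a, rfl⟩, value a, hasContFract_value a, ha⟩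

instance countable_rationalFunctions : Countable rationalFunctions := by
  have : Countable F2[X] := by
    rw [← Cardinal.mk_le_aleph0_iff]
    exact Polynomial.cardinalMk_le_max.trans (by simp)
  have hsurj : Function.Surjective fun pq : F2[X] × F2[X] =>
      (⟨ratEval valuation_x (algebraMap _ _ pq.1 / algebraMap _ _ pq.2),
        ratEval_mem valuation_x x_mem_rationalFunctions _⟩ : rationalFunctions) := by
    rintro ⟨f, hf⟩
    obtain ⟨r, rfl⟩ := exists_ratEval_eq hf
    obtain ⟨p, q, -, rfl⟩ := IsFractionRing.div_surjective (A := F2[X]) r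
    exact ⟨(p, q), rfl⟩
  exact hsurj.countable

theorem countable_isAlgebraic {K L : Type*} [Field K] [Field L] [Algebra K L] [Countable K] :
    {f : L | IsAlgebraic K f}.Countable :=
  Algebraic.countable K L

theorem countable_algebraicWords : algebraicWords.Countable :=
  (countable_isAlgebraic (K := rationalFunctions)).preimage_of_injOn value_injective.injOn

theorem infinite_algebraicWords : algebraicWords.Infinite := by
  refine Set.infinite_of_injective_forall_mem (f := fun n : ℕ => Pi.single n (1 : F2)) ?_ ?_
  · intro m n hmn
    by_contra h
    have := congrFun hmn m
    simp [h] at this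
  · intro n
    refine isAlgebraic_value_of_eventuallySame ?_ isAlgebraic_value_zero
    filter_upwards [eventually_gt_atTop n] with j hj
    exact Pi.single_eq_of_ne hj.ne' _

/-! ### Enumeration of the algebraic sequences and the permanent -/

theorem exists_injective_tableau : ∃ T : Tableau F2[X],
    Function.Injective T ∧ rowWords T = algebraicBSSequences := by
  have := infinite_algebraicWords.to_subtype
  have := countable_algebraicWords.to_subtype
  obtain ⟨e⟩ := nonempty_equiv_of_countable (α := ℕ) (β := algebraicWords)
  refine ⟨fun i => quotients (e i),
    quotients_injective.comp (Subtype.val_injective.comp e.injective), ?_⟩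
  rw [algebraicBSSequences_eq, rowWords,
    show (fun i => quotients (e i)) = (fun w : algebraicWords => quotients w) ∘ e from rfl,
    e.surjective.range_comp]
  exact (Set.image_eq_range _ _).symm

theorem permanent_eq_transcendentalBSSequences {T : Tableau F2[X]}
    (hT : rowWords T = algebraicBSSequences) : permanent T = transcendentalBSSequences := by
  have hrow : ∀ i, ∃ a, a ∈ algebraicWords ∧ quotients a = T i := fun i => by
    have : T i ∈ rowWords T := ⟨i, rfl⟩
    rwa [hT, algebraicBSSequences_eq] at this
  choose S hS hST using hrow
  have hSrow : rowWords S = algebraicWords := by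
    refine Set.Subset.antisymm (Set.range_subset_iff.2 hS) fun a ha => ?_
    have : quotients a ∈ rowWords T := by
      rw [hT, algebraicBSSequences_eq]
      exact ⟨a, ha, rfl⟩
    obtain ⟨i, hi⟩ := this
    exact ⟨i, quotients_injective ((hST i).trans hi)⟩
  have hperm : permanent S = algebraicWordsᶜ := by
    rw [← hSrow]
    refine permanent_eq_compl (fun i => ?_) (fun i w hw => ?_)
    · rw [hSrow]
      exact isAlgebraic_value_add_one (hS i)
    · rw [hSrow]
      exact isAlgebraic_value_of_eventuallySame hw (hS i)
  rw [transcendentalBSSequences_eq, ← hperm]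
  ext A
  constructor
  · rintro ⟨π, hπ⟩
    exact ⟨fun j => S (π j) j, ⟨π, fun _ => rfl⟩,
      funext fun j => (congrFun (hST (π j)) j).trans (hπ j).symm⟩
  · rintro ⟨w, ⟨π, hπ⟩, rfl⟩
    exact ⟨π, fun j => by rw [← hST, quotients, quotients, hπ]⟩

theorem disjoint_transcendental_algebraic :
    transcendentalBSSequences ∩ algebraicBSSequences = ∅ := by
  rw [transcendentalBSSequences_eq, algebraicBSSequences_eq,
    ← Set.image_inter quotients_injective, Set.compl_inter_self, Set.image_empty]

theorem values_transcendentalBSSequences :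
    {f | ∃ A ∈ transcendentalBSSequences, HasContFract A f} =
      {f | IsBSElement f ∧ Transcendental rationalFunctions f} := by
  ext f
  constructor
  · rintro ⟨A, ⟨hA, g, hg, htr⟩, hf⟩
    obtain rfl := tendsto_nhds_unique hf hg
    exact ⟨⟨A, hA, hf⟩, htr⟩
  · rintro ⟨⟨A, hA, hf⟩, htr⟩
    exact ⟨A, ⟨hA, f, hf, htr⟩, hf⟩

end BaumSweet

end

theorem mainTheorem6 :
    (∃ T : BaumSweet.Tableau (Polynomial BaumSweet.F2),
      Function.Injective T ∧ BaumSweet.rowWords T = BaumSweet.algebraicBSSequences) ∧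
    ∀ T : BaumSweet.Tableau (Polynomial BaumSweet.F2),
      BaumSweet.rowWords T = BaumSweet.algebraicBSSequences →
        BaumSweet.IsCantorian T ∧
        BaumSweet.permanent T = BaumSweet.transcendentalBSSequences ∧
        {f | ∃ A ∈ BaumSweet.permanent T, BaumSweet.HasContFract A f} =
          {f | BaumSweet.IsBSElement f ∧
            Transcendental BaumSweet.rationalFunctions f} := by
  refine ⟨BaumSweet.exists_injective_tableau, fun T hT => ?_⟩
  have hperm := BaumSweet.permanent_eq_transcendentalBSSequences hT
  refine ⟨?_, hperm, ?_⟩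
  · rw [BaumSweet.IsCantorian, hperm, hT]
    exact BaumSweet.disjoint_transcendental_algebraic
  · rw [hperm]
    exact BaumSweet.values_transcendentalBSSequences
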